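/- Let $\mathbb{K}$ be an infinite field of characteristic $2$ and let $\mathrm{UT}_3^{(-)}$ be the Lie algebra of upper triangular $3\times3$ matrices over $\mathbb{K}$ with bracket $[A,B]=AB-BA$. For an abelian group $G$ (written additively) and $g,h\in G$, let $\Gamma(g,h)$ be the elementary $G$-grading on $\mathrm{UT}_3^{(-)}$ with $\deg e_{ii}=0$, $\deg e_{12}=g$, $\deg e_{23}=h$, $\deg e_{13}=g+h$. The canonical $\mathbb{Z}$-grading is $\Delta=\Gamma(1,1)$ with $G=\mathbb{Z}$, and the almost canonical $\mathbb{Z}_2$-grading is $\Gamma=\Gamma(1,1)$ with $G=\mathbb{Z}_2=\mathbb{Z}/2\mathbb{Z}$. Let $\mathcal{L}(X^G)$ be the free Lie algebra over $\mathbb{K}$ on the variables $x_{i,g}$ ($i\in\mathbb{N}$, $g\in G$), graded by $\deg x_{i,g}=g$. A $T_G$-ideal is an ideal of $\mathcal{L}(X^G)$ stable under all graded endomorphisms; $\langle S\rangle_{T_G}$ is the smallest $T_G$-ideal containing $S$; $\mathrm{Id}_G(\cdot)$ is the ideal of $G$-graded polynomial identities, i.e. of all $f\in\mathcal{L}(X^G)$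 that vanish under every graded homomorphism from $\mathcal{L}(X^G)$ to $\mathrm{UT}_3^{(-)}$ with the given grading. A $T_G$-ideal $I$ has the Specht property if every $T_G$-ideal $J\supseteq I$ is finitely generated as a $T_G$-ideal. Let $\alpha:\mathbb{Z}\to\mathbb{Z}_2$ be the canonical projection and let $\pi:\mathcal{L}(X^{\mathbb{Z}_2})\to\mathcal{L}(X^{\mathbb{Z}})$ be the Lie homomorphism with $\pi(x_{i,h})=\sum_{g} x_{i,g}$, the sum being over all $g$ in the support of $\Delta$ with $\alpha(g)=h$; that is, with $y_i=x_{i,0}$ and $z_i=x_{i,1}$, $\pi(y_i)=x_{i,0}+x_{i,2}$ and $\pi(z_i)=x_{i,1}$. For $k\ge2$ let $c_k=[z_1,y_1,\ldots,y_k,z_1]\in\mathcal{L}(X^{\mathbb{Z}_2})$ (left-normed commutator), and for $n\ge2$ put $$I_n=\langle\pi(c_2),\ldots,\pi(c_n)\rangle_{T_{\mathbb{Z}}}+\mathrm{Id}_{\mathbb{Z}}(\mathrm{UT}_3^{(-)},\Delta),\qquad J_n=\langle c_2,\ldots,c_n\rangle_{T_{\mathbb{Z}_2}}+\mathrm{Id}_{\mathbb{Z}_2}(\mathrm{UT}_3^{(-)},\Gamma).$$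 **Proposition.** The $T_{\mathbb{Z}_2}$-ideal $\mathrm{Id}_{\mathbb{Z}_2}(\mathrm{UT}_3^{(-)},\Gamma)$ does not have the Specht property. Moreover, $\Gamma$ is the coarsening $\Delta^\alpha$ of $\Delta$ along $\alpha$ (that is, $\Gamma_h=\bigoplus_{\alpha(g)=h}\Delta_g$ for each $h\in\mathbb{Z}_2$); both chains $I_2\subsetneq I_3\subsetneq\cdots$ and $J_2\subsetneq J_3\subsetneq\cdots$ are strictly ascending; and $\pi(J_n)\subseteq I_n$ for every $n\ge2$. -/

import Mathlib

attribute [local instance 100] LieRing.ofAssociativeRing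

namespace GradedIdentities

/-! ### Upper triangular matrices of order 3 and their elementary gradings -/

/-- The Lie algebra of upper triangular `3 × 3` matrices, with bracket `[A, B] = AB - BA`. -/
def UT3 (K : Type*) [Field K] : LieSubalgebra K (Matrix (Fin 3) (Fin 3) K) where
  carrier := {A | ∀ i j, j < i → A i j = 0}
  zero_mem' := by
    intro i j _
    rfl
  add_mem' := by
    intro A B hA hB i j hij
    simp [hA i j hij, hB i j hij]
  smul_mem' := by
    intro c A hA i j hij
    simp [hA i j hij]
  lie_mem' := by
    intro A B hA hB
    have key : ∀ C D : Matrix (Fin 3) (Fin 3) K, (∀ i j, j < i → C i j = 0) →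
        (∀ i j, j < i → D i j = 0) → ∀ i j, j < i → (C * D) i j = 0 := by
      intro C D hC hD i j hij
      rw [Matrix.mul_apply]
      refine Finset.sum_eq_zero fun k _ => ?_
      rcases lt_or_ge k i with h | h
      · rw [hC i k h, zero_mul]
      · rw [hD k j (lt_of_lt_of_le hij h), mul_zero]
    intro i j hij
    rw [Ring.lie_def, Matrix.sub_apply, key A B hA hB i j hij, key B A hB hA i j hij, sub_zero]

/-- The degree of the matrix unit `e_{ij}` in the elementary grading `Γ(g, h)`: all `e_{ii}` have
degree `0`, and `e_{12}`, `e_{23}`, `e_{13}` have degrees `g`, `h`, `g + h`. -/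
def unitDegree {G : Type*} [AddCommGroup G] (g h : G) (i j : Fin 3) : G :=
  ![0, g, g + h] j - ![0, g, g + h] i

/-- The elementary grading `Γ(g, h)` on `UT3 K`: the component of degree `a` is spanned by the
matrix units of degree `a`, i.e. it consists of the upper triangular matrices supported on them. -/
def elementaryGrading (K : Type*) [Field K] {G : Type*} [AddCommGroup G] (g h : G) :
    G → Submodule K (UT3 K) := fun a =>
  { carrier := {A | ∀ i j, (A : Matrix (Fin 3) (Fin 3) K) i j ≠ 0 → unitDegree g h i j = a}
    zero_mem' := fun i j hij => absurd rfl hij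
    add_mem' := by
      intro A B hA hB i j hij
      by_cases h0 : (A : Matrix (Fin 3) (Fin 3) K) i j = 0
      · refine hB i j fun h1 => hij ?_
        simp [h0, h1]
      · exact hA i j h0
    smul_mem' := by
      intro c A hA i j hij
      refine hA i j fun h0 => hij ?_
      simp [h0] }

/-- The coarsening `Γ^α` of a `G`-grading `Γ` along a homomorphism `α : G → H`. -/
def coarsening {K M G H : Type*} [Field K] [LieRing M] [LieAlgebra K M]
    [AddCommGroup G] [AddCommGroup H] (α : G →+ H) (Γ : G → Submodule K M) : H → Submodule K M :=
  fun h => ⨆ g : {g : G // α g = h}, Γ g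

/-! ### Free graded Lie algebras and T-ideals -/

/-- The free Lie algebra `L(X^G)` on the variables `x_{i,g}`, `i ∈ ℕ`, `g ∈ G`. -/
abbrev FreeGr (K G : Type*) [Field K] : Type _ := FreeLieAlgebra K (ℕ × G)

/-- The variable `x_{i,g}`. -/
noncomputable def var (K : Type*) {G : Type*} [Field K] (i : ℕ) (g : G) : FreeGr K G :=
  FreeLieAlgebra.of K (i, g)

/-- `IsMonomial g w`: `w` is a (possibly nested) Lie monomial in the variables, whose
`G`-degree, the sum of the degrees of the variables occurring in it, is `g`. -/
inductive IsMonomial (K : Type*) {G : Type*} [Field K] [AddCommGroup G] : G → FreeGr K G → Prop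
  | var (i : ℕ) (g : G) : IsMonomial K g (var K i g)
  | lie {g h : G} {u v : FreeGr K G} :
      IsMonomial K g u → IsMonomial K h v → IsMonomial K (g + h) ⁅u, v⁆

/-- The natural `G`-grading of the free Lie algebra `L(X^G)`. -/
noncomputable def freeGrading (K G : Type*) [Field K] [AddCommGroup G] : G → Submodule K (FreeGr K G) :=
  fun g => Submodule.span K {w | IsMonomial K g w}

/-- A Lie homomorphism is graded if it maps each homogeneous component to the component of the
same degree. -/
def IsGradedHom {K G L M : Type*} [Field K] [LieRing L] [LieAlgebra K L] [LieRing M]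
    [LieAlgebra K M] (Λ : G → Submodule K L) (Γ : G → Submodule K M) (φ : L →ₗ⁅K⁆ M) : Prop :=
  ∀ g, ∀ x ∈ Λ g, φ x ∈ Γ g

/-- The ideal `Id_G(M, Γ)` of graded polynomial identities of `M` with the `G`-grading `Γ`. -/
noncomputable def gradedId {K G M : Type*} [Field K] [AddCommGroup G] [LieRing M] [LieAlgebra K M]
    (Γ : G → Submodule K M) : LieIdeal K (FreeGr K G) where
  carrier := {f | ∀ φ : FreeGr K G →ₗ⁅K⁆ M, IsGradedHom (freeGrading K G) Γ φ → φ f = 0}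
  zero_mem' := fun φ _ => map_zero φ
  add_mem' := by
    intro f₁ f₂ h₁ h₂ φ hφ
    rw [map_add, h₁ φ hφ, h₂ φ hφ, add_zero]
  smul_mem' := by
    intro c f h φ hφ
    rw [map_smul, h φ hφ, smul_zero]
  lie_mem := by
    intro w f h φ hφ
    rw [LieHom.map_lie, h φ hφ, lie_zero]

/-- A `T_G`-ideal: an ideal of `L(X^G)` stable under all graded endomorphisms. -/
def IsTIdeal {K G : Type*} [Field K] [AddCommGroup G] (I : LieIdeal K (FreeGr K G)) : Prop :=
  ∀ φ : FreeGr K G →ₗ⁅K⁆ FreeGr K G, IsGradedHom (freeGrading K G) (freeGrading K G) φ →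
    ∀ f ∈ I, φ f ∈ I

/-- The `T_G`-ideal `⟨S⟩_{T_G}` generated by `S`. -/
noncomputable def tSpan {K G : Type*} [Field K] [AddCommGroup G] (S : Set (FreeGr K G)) :
    LieIdeal K (FreeGr K G) :=
  sInf {I | IsTIdeal I ∧ S ⊆ I}

/-- The Specht property of a `T_G`-ideal `I`: every `T_G`-ideal containing `I` is finitely
generated as a `T_G`-ideal. -/
def HasSpechtProperty {K G : Type*} [Field K] [AddCommGroup G]
    (I : LieIdeal K (FreeGr K G)) : Prop :=
  ∀ J : LieIdeal K (FreeGr K G), IsTIdeal J → I ≤ J → ∃ S : Set (FreeGr K G), S.Finite ∧ J = tSpan S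

/-! ### Transfer along a coarsening -/

/-- For a homomorphism `α : G → H` and a grading `Γ` with finite support, the homomorphism
`π : L(X^H) → L(X^G)` with `π(x_{i,h}) = ∑ x_{i,g}`, the sum being over all `g` in the support of
`Γ` with `α g = h`. -/
noncomputable def transfer {K G H M : Type*} [Field K] [AddCommGroup G] [AddCommGroup H]
    [LieRing M] [LieAlgebra K M] (α : G →+ H) (Γ : G → Submodule K M) :
    FreeGr K H →ₗ⁅K⁆ FreeGr K G :=
  FreeLieAlgebra.lift K fun p => ∑ᶠ g ∈ {g : G | α g = p.2 ∧ Γ g ≠ ⊥}, var K p.1 g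

/-- The left-normed commutator `c_k = [z_1, y_1, …, y_k, z_1]`, where `z_i` and `y_i` are the
variables of degree `1` and `0` respectively. -/
noncomputable def c (K : Type*) [Field K] (k : ℕ) : FreeGr K (ZMod 2) :=
  let z : ℕ → FreeGr K (ZMod 2) := fun i => var K i 1
  let y : ℕ → FreeGr K (ZMod 2) := fun i => var K i 0
  ⁅(List.range k).foldl (fun w i => ⁅w, y (i + 1)⁆) (z 1), z 1⁆

/-- The canonical `ℤ`-grading on `UT3 K`. -/
def canonicalGrading (K : Type*) [Field K] : ℤ → Submodule K (UT3 K) := elementaryGrading K 1 1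

/-- The almost canonical `ℤ/2`-grading `Γ(1, 1)` on `UT3 K`. -/
def almostCanonicalGrading (K : Type*) [Field K] : ZMod 2 → Submodule K (UT3 K) :=
  elementaryGrading K 1 1

/-- The canonical projection `ℤ → ℤ/2`. -/
def proj : ℤ →+ ZMod 2 := Int.castAddHom (ZMod 2)

/-- The `T_ℤ`-ideal `⟨π(c_2), …, π(c_{n+2})⟩ + Id_ℤ` for the canonical grading. -/
noncomputable def canonicalChain (K : Type*) [Field K] (n : ℕ) : LieIdeal K (FreeGr K ℤ) :=
  tSpan ((fun k => transfer proj (canonicalGrading K) (c K k)) '' Set.Icc 2 (n + 2)) ⊔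
    gradedId (canonicalGrading K)

/-- The `T_{ℤ/2}`-ideal `⟨c_2, …, c_{n+2}⟩ + Id_{ℤ/2}` for the almost canonical grading. -/
noncomputable def almostCanonicalChain (K : Type*) [Field K] (n : ℕ) : LieIdeal K (FreeGr K (ZMod 2)) :=
  tSpan (c K '' Set.Icc 2 (n + 2)) ⊔ gradedId (almostCanonicalGrading K)

end GradedIdentities

namespace GradedIdentities

open MvPolynomial

/-! ### A Lie algebra of polynomials -/

/-! Strictness of both chains is detected by one family of test algebras. `PolyLie K N` consists of
linear forms (degree 0), polynomials (degree u) and central scalars (degree u + u). Forms act on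
polynomials by multiplication, and two polynomials pair to the coefficient of X 0 ⋯ X N in their
product. Characteristic 2 makes this a Lie algebra. If x has only a polynomial part f and each m_i
has a linear form y_i and no polynomial part, then [x, m_1, …, m_k, x] is the scalar given by the
coefficient of X 0 ⋯ X N in f² y_1 ⋯ y_k. By Frobenius only squares of monomials occur in f², so
this is 0 for k ≤ N, while f = 1 and the variables X 0, …, X N give 1 for k = N + 1. Hence c_k holds
in `PolyLie K N` for k ≤ N, but c_{N+1} does not.

The main point is that `PolyLie K N` satisfies every graded identity of UT₃ (`PolyLie.gradedId_le`).
Evaluating at two points s, t turns a form y and a polynomial f into a matrix with diagonal 0, y(s),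
y(s) + y(t) and with entries f(s), f(t) above it. The corner entry of a commutator is then built
from alternating expressions f(s)g(t) - g(s)f(t). The functional `halfCoeff` sends such an
expression to the coefficient of X 0 ⋯ X N in fg and kills multiples by y(s) + y(t), so it recovers
the scalar part. Over an infinite field, vanishing at all s, t therefore forces vanishing in
`PolyLie K N`.

The Specht property fails because the union of a strict chain of T-ideals is not finitely generated.
The inclusion π(J_n) ⊆ I_n rests on lifting graded endomorphisms along π modulo identities
(`exists_lift_transfer`). -/

/-- The exponent of the squarefree monomial `X 0 * ⋯ * X N`. -/
noncomputable def sqfreeExp (N : ℕ) : ℕ →₀ ℕ := ∑ i ∈ Finset.range (N + 1), Finsupp.single i 1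

theorem sqfreeExp_apply (N i : ℕ) : sqfreeExp N i = if i < N + 1 then 1 else 0 := by
  simp [sqfreeExp, Finsupp.finsetSum_apply, Finsupp.single_apply]

theorem degree_sqfreeExp (N : ℕ) : (sqfreeExp N).degree = N + 1 := by
  simp [sqfreeExp, map_sum]

theorem coeff_sqfreeExp_prod (K : Type*) [Field K] (N : ℕ) :
    coeff (sqfreeExp N) (∏ i ∈ Finset.range (N + 1), (X i : MvPolynomial ℕ K)) = 1 := by
  have : ∏ i ∈ Finset.range (N + 1), (X i : MvPolynomial ℕ K) = monomial (sqfreeExp N) 1 := by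
    rw [sqfreeExp, monomial_sum_one]
    rfl
  rw [this, coeff_monomial, if_pos rfl]

/-- In characteristic two, multiplying a form of low degree by a square does not produce a
squarefree monomial of higher degree. -/
theorem coeff_sqfreeExp_sq_mul {K : Type*} [Field K] [CharP K 2] {N k : ℕ} (hk : k < N + 1)
    {p : MvPolynomial ℕ K} (hp : p.IsHomogeneous k) (f : MvPolynomial ℕ K) :
    coeff (sqfreeExp N) (f * f * p) = 0 := by
  induction f using MvPolynomial.induction_on' with
  | monomial m a =>
    -- A square m² divides a squarefree monomial only for m = 1; what remains is a coefficient of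
    -- `p`, whose degree is too small.
    rw [monomial_mul, coeff_monomial_mul']
    split_ifs with h
    · have hm : m + m = 0 := by
        ext i
        have := h i
        rw [sqfreeExp_apply] at this
        simp only [Finsupp.add_apply, Finsupp.zero_apply] at this ⊢
        split_ifs at this <;> omega
      rw [hm, tsub_zero, hp.coeff_eq_zero (by rw [degree_sqfreeExp]; omega), mul_zero]
    · rfl
  | add f g hf hg =>
    have : (f + g) * (f + g) * p = f * f * p + g * g * p := by
      rw [CharTwo.add_mul_self, add_mul]
    rw [this, coeff_add, hf, hg, add_zero]

/-- This is what makes the scalar pairing of polynomials alternating, not merely symmetric. -/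
theorem coeff_sqfreeExp_mul_self {K : Type*} [Field K] [CharP K 2] (N : ℕ)
    (f : MvPolynomial ℕ K) : coeff (sqfreeExp N) (f * f) = 0 := by
  simpa using coeff_sqfreeExp_sq_mul (N := N) (Nat.succ_pos N) (isHomogeneous_one ℕ K) f

/-- Triples consisting of a linear form, a polynomial and a scalar. -/
def PolyLie (K : Type*) [Field K] (_ : ℕ) : Type _ :=
  homogeneousSubmodule ℕ K 1 × MvPolynomial ℕ K × K

namespace PolyLie

variable {K : Type*} [Field K] {N : ℕ}

noncomputable instance : AddCommGroup (PolyLie K N) :=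
  inferInstanceAs (AddCommGroup (homogeneousSubmodule ℕ K 1 × MvPolynomial ℕ K × K))

noncomputable instance : Module K (PolyLie K N) :=
  inferInstanceAs (Module K (homogeneousSubmodule ℕ K 1 × MvPolynomial ℕ K × K))

/-- The linear form of a triple, as a polynomial. -/
noncomputable def form : PolyLie K N →ₗ[K] MvPolynomial ℕ K :=
  (homogeneousSubmodule ℕ K 1).subtype ∘ₗ
    LinearMap.fst K (homogeneousSubmodule ℕ K 1) (MvPolynomial ℕ K × K)

/-- The polynomial of a triple. -/
noncomputable def poly : PolyLie K N →ₗ[K] MvPolynomial ℕ K :=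
  LinearMap.fst K (MvPolynomial ℕ K) K ∘ₗ
    LinearMap.snd K (homogeneousSubmodule ℕ K 1) (MvPolynomial ℕ K × K)

/-- The scalar of a triple. -/
noncomputable def scalar : PolyLie K N →ₗ[K] K :=
  LinearMap.snd K (MvPolynomial ℕ K) K ∘ₗ
    LinearMap.snd K (homogeneousSubmodule ℕ K 1) (MvPolynomial ℕ K × K)

@[ext]
theorem ext {x y : PolyLie K N} (h₁ : form x = form y) (h₂ : poly x = poly y)
    (h₃ : scalar x = scalar y) : x = y :=
  Prod.ext (Subtype.ext h₁) (Prod.ext h₂ h₃)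

/-- The triple with the given entries. -/
def mk (y : homogeneousSubmodule ℕ K 1) (f : MvPolynomial ℕ K) (k : K) : PolyLie K N := (y, f, k)

@[simp] theorem form_mk (y : homogeneousSubmodule ℕ K 1) (f : MvPolynomial ℕ K) (k : K) :
    form (mk y f k : PolyLie K N) = y := rfl

@[simp] theorem poly_mk (y : homogeneousSubmodule ℕ K 1) (f : MvPolynomial ℕ K) (k : K) :
    poly (mk y f k : PolyLie K N) = f := rfl

@[simp] theorem scalar_mk (y : homogeneousSubmodule ℕ K 1) (f : MvPolynomial ℕ K) (k : K) :
    scalar (mk y f k : PolyLie K N) = k := rfl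

theorem isHomogeneous_form (x : PolyLie K N) : (form x).IsHomogeneous 1 :=
  (mem_homogeneousSubmodule 1 _).1 (Prod.fst x : homogeneousSubmodule ℕ K 1).2

/-- Linear forms act on polynomials by multiplication; two polynomials `f`, `g` are sent to the
coefficient of `X 0 * ⋯ * X N` in `f * g`. -/
noncomputable instance : Bracket (PolyLie K N) (PolyLie K N) where
  bracket x y := mk 0 (poly x * form y - poly y * form x) (coeff (sqfreeExp N) (poly x * poly y))

@[simp] theorem form_lie (x y : PolyLie K N) : form ⁅x, y⁆ = 0 := rfl

@[simp] theorem poly_lie (x y : PolyLie K N) :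
    poly ⁅x, y⁆ = poly x * form y - poly y * form x := rfl

@[simp] theorem scalar_lie (x y : PolyLie K N) :
    scalar ⁅x, y⁆ = coeff (sqfreeExp N) (poly x * poly y) := rfl

/-- Bracketing with an element without polynomial part multiplies by its linear form. Its scalar is
central, so nothing is required of it; over ℤ/2 it can be nonzero in degree 0. -/
theorem foldl_lie {ι : Type*} (m : ι → PolyLie K N) (l : List ι) (hm : ∀ i ∈ l, poly (m i) = 0)
    (x : PolyLie K N) (hx : form x = 0) (hx' : scalar x = 0) :
    form (l.foldl (fun w i => ⁅w, m i⁆) x) = 0 ∧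
      scalar (l.foldl (fun w i => ⁅w, m i⁆) x) = 0 ∧
      poly (l.foldl (fun w i => ⁅w, m i⁆) x) = poly x * (l.map fun i => form (m i)).prod := by
  induction l generalizing x with
  | nil => simp [hx, hx']
  | cons i l ih =>
    have hi := hm i (by simp)
    obtain ⟨h₁, h₂, h₃⟩ := ih (fun j hj => hm j (by simp [hj])) ⁅x, m i⁆ (by simp) (by simp [hi])
    refine ⟨h₁, h₂, ?_⟩
    rw [List.foldl_cons, h₃]
    simp [hi, mul_assoc]

theorem isHomogeneous_prod_form {ι : Type*} (m : ι → PolyLie K N) (l : List ι) :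
    (l.map fun i => form (m i)).prod.IsHomogeneous l.length := by
  induction l with
  | nil => simpa using isHomogeneous_one ℕ K
  | cons i l ih =>
    rw [List.map_cons, List.prod_cons, List.length_cons, add_comm]
    exact (isHomogeneous_form (m i)).mul ih

/-- Commutators `[x, m₁, …, m_k, x]` with `k ≤ N` vanish for odd `x` and even `m_i`. -/
theorem lie_foldl_lie {ι : Type*} (m : ι → PolyLie K N) (l : List ι)
    (hm : ∀ i ∈ l, poly (m i) = 0) (x : PolyLie K N) (hx : form x = 0) (hx' : scalar x = 0) :
    ⁅l.foldl (fun w i => ⁅w, m i⁆) x, x⁆ =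
      mk 0 0 (coeff (sqfreeExp N) (poly x * poly x * (l.map fun i => form (m i)).prod)) := by
  obtain ⟨h₁, h₂, h₃⟩ := foldl_lie m l hm x hx hx'
  ext1
  · simp
  · simp [h₁, hx]
  · rw [scalar_lie, h₃, scalar_mk, mul_right_comm]

/-! ### The Lie algebra axioms in characteristic 2 -/

variable [CharP K 2]

noncomputable instance : LieRing (PolyLie K N) where
  add_lie x y z := by
    ext1
    · simp
    · simp; ring
    · simp [add_mul]
  lie_add x y z := by
    ext1
    · simp
    · simp; ring
    · simp [mul_add]
  lie_self x := by
    ext1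
    · simp
    · simp
    · simp [coeff_sqfreeExp_mul_self]
  leibniz_lie x y z := by
    ext1
    · simp
    · simp; ring
    -- In the scalar part of the Jacobi identity two terms cancel outright and the remaining ones
    -- occur twice.
    · have h2 : (2 : MvPolynomial ℕ K) = 0 := CharTwo.two_eq_zero
      simp only [scalar_lie, map_add, ← coeff_add, poly_lie]
      congr 1
      linear_combination (poly y * form x * poly z - poly x * form y * poly z) * h2

noncomputable instance : LieAlgebra K (PolyLie K N) where
  lie_smul a x y := by
    ext1
    · simp
    · simp [smul_sub]
    · simp

end PolyLie

/-! ### Gradings and graded homomorphisms -/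

/-- A family of subspaces that is compatible with the bracket. -/
def IsLieGraded {K G M : Type*} [Field K] [AddCommGroup G] [LieRing M] [LieAlgebra K M]
    (Γ : G → Submodule K M) : Prop :=
  ∀ g h, ∀ x ∈ Γ g, ∀ y ∈ Γ h, ⁅x, y⁆ ∈ Γ (g + h)

section

variable {K G H M : Type*} [Field K] [AddCommGroup G] [AddCommGroup H] [LieRing M] [LieAlgebra K M]

theorem IsLieGraded.isGradedHom {Γ : G → Submodule K M} (hΓ : IsLieGraded Γ)
    {φ : FreeGr K G →ₗ⁅K⁆ M} (hφ : ∀ i g, φ (var K i g) ∈ Γ g) :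
    IsGradedHom (freeGrading K G) Γ φ := by
  intro g x hx
  have key : ∀ g (w : FreeGr K G), IsMonomial K g w → φ w ∈ Γ g := by
    intro g w hw
    induction hw with
    | var i g => exact hφ i g
    | lie _ _ h₁ h₂ =>
      rw [LieHom.map_lie]
      exact hΓ _ _ _ h₁ _ h₂
  have : freeGrading K G g ≤ (Γ g).comap (φ : FreeGr K G →ₗ[K] M) :=
    Submodule.span_le.2 fun w hw => key g w hw
  exact this hx

theorem var_mem_freeGrading (i : ℕ) (g : G) : var K i g ∈ freeGrading K G g :=
  Submodule.subset_span (IsMonomial.var i g)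

theorem isLieGraded_of_span {S : G → Set M}
    (hS : ∀ g h, ∀ x ∈ S g, ∀ y ∈ S h, ⁅x, y⁆ ∈ Submodule.span K (S (g + h))) :
    IsLieGraded fun g => Submodule.span K (S g) := by
  intro g h x hx y hy
  induction hx using Submodule.span_induction with
  | zero => rw [zero_lie]; exact zero_mem _
  | add a b _ _ ha hb => rw [add_lie]; exact add_mem ha hb
  | smul c a _ ha => rw [smul_lie]; exact Submodule.smul_mem _ _ ha
  | mem a ha =>
    induction hy using Submodule.span_induction with
    | zero => rw [lie_zero]; exact zero_mem _
    | add b c _ _ hb hc => rw [lie_add]; exact add_mem hb hc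
    | smul c b _ hb => rw [lie_smul]; exact Submodule.smul_mem _ _ hb
    | mem b hb => exact hS g h a ha b hb

theorem isLieGraded_freeGrading : IsLieGraded (freeGrading K G) :=
  isLieGraded_of_span fun _ _ _ hx _ hy => Submodule.subset_span (IsMonomial.lie hx hy)

theorem IsLieGraded.coarsening {Γ : G → Submodule K M} (hΓ : IsLieGraded Γ) (α : G →+ H) :
    IsLieGraded (coarsening α Γ) := by
  have : GradedIdentities.coarsening α Γ =
      fun h => Submodule.span K (⋃ g : {g : G // α g = h}, (Γ g : Set M)) := by
    funext h
    rw [GradedIdentities.coarsening, Submodule.iSup_eq_span]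
  rw [this]
  refine isLieGraded_of_span fun g h x hx y hy => ?_
  obtain ⟨⟨a, ha⟩, hx⟩ := Set.mem_iUnion.1 hx
  obtain ⟨⟨b, hb⟩, hy⟩ := Set.mem_iUnion.1 hy
  refine Submodule.subset_span (Set.mem_iUnion.2 ⟨⟨a + b, ?_⟩, hΓ a b x hx y hy⟩)
  rw [map_add, ha, hb]

end

/-- A Lie subalgebra of the free Lie algebra containing all variables is everything. -/
theorem mem_of_var_mem {K G : Type*} [Field K] (S : LieSubalgebra K (FreeGr K G)) (hS : ∀ i g, var K i g ∈ S)
    (w : FreeGr K G) : w ∈ S := by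
  let F : FreeGr K G →ₗ⁅K⁆ S := FreeLieAlgebra.lift K fun p => ⟨var K p.1 p.2, hS p.1 p.2⟩
  have : S.incl.comp F = LieHom.id := by
    refine FreeLieAlgebra.hom_ext fun p => ?_
    simp [F, var]
  have h := congrArg (fun φ : FreeGr K G →ₗ⁅K⁆ FreeGr K G => φ w) this
  have h' : ((F w : S) : FreeGr K G) = w := h
  rw [← h']
  exact (F w).2

/-- The degree of a matrix unit is a difference of potentials at its two indices, so it telescopes
in a product. -/
theorem isLieGraded_elementaryGrading {K G : Type*} [Field K] [AddCommGroup G] (g h : G) :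
    IsLieGraded (elementaryGrading K g h) := by
  have key : ∀ (a b : G) (A B : Matrix (Fin 3) (Fin 3) K),
      (∀ i j, A i j ≠ 0 → unitDegree g h i j = a) → (∀ i j, B i j ≠ 0 → unitDegree g h i j = b) →
      ∀ i j, (A * B) i j ≠ 0 → unitDegree g h i j = a + b := by
    intro a b A B hA hB i j hij
    rw [Matrix.mul_apply] at hij
    obtain ⟨k, -, hk⟩ := Finset.exists_ne_zero_of_sum_ne_zero hij
    rw [← hA i k (left_ne_zero_of_mul hk), ← hB k j (right_ne_zero_of_mul hk)]
    simp only [unitDegree]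
    abel
  intro a b A hA B hB i j hij
  rw [LieSubalgebra.coe_bracket, Ring.lie_def, Matrix.sub_apply] at hij
  by_cases h0 : ((A : Matrix (Fin 3) (Fin 3) K) * (B : Matrix (Fin 3) (Fin 3) K)) i j = 0
  · rw [add_comm]
    refine key b a _ _ hB hA i j fun h1 => hij ?_
    rw [h0, h1, sub_zero]
  · exact key a b _ _ hA hB i j h0

namespace PolyLie

/-- The grading of `PolyLie K N` in which linear forms have degree `0`, polynomials degree `u` and
scalars degree `u + u`. -/
def grading (K : Type*) [Field K] (N : ℕ) {G : Type*} [AddCommGroup G] (u : G) :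
    G → Submodule K (PolyLie K N) := fun a =>
  { carrier := {x | (form x ≠ 0 → a = 0) ∧ (poly x ≠ 0 → a = u) ∧ (scalar x ≠ 0 → a = u + u)}
    zero_mem' := by simp
    add_mem' := by
      intro x y hx hy
      have key : ∀ {V : Type _} [AddCommGroup V] {v w : V} {P : Prop}, (v ≠ 0 → P) →
          (w ≠ 0 → P) → v + w ≠ 0 → P := by
        intro V _ v w P hv hw h
        by_cases h0 : v = 0
        · exact hw fun h1 => h (by rw [h0, h1, add_zero])
        · exact hv h0
      simp only [Set.mem_ofPred_eq, map_add] at hx hy ⊢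
      exact ⟨key hx.1 hy.1, key hx.2.1 hy.2.1, key hx.2.2 hy.2.2⟩
    smul_mem' := by
      intro c x hx
      simp only [Set.mem_ofPred_eq, map_smul] at hx ⊢
      exact ⟨fun h => hx.1 (right_ne_zero_of_smul h), fun h => hx.2.1 (right_ne_zero_of_smul h),
        fun h => hx.2.2 (right_ne_zero_of_smul h)⟩ }

theorem mem_grading {K : Type*} [Field K] {N : ℕ} {G : Type*} [AddCommGroup G] {u a : G}
    {x : PolyLie K N} : x ∈ grading K N u a ↔
      (form x ≠ 0 → a = 0) ∧ (poly x ≠ 0 → a = u) ∧ (scalar x ≠ 0 → a = u + u) := Iff.rfl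

theorem isLieGraded_grading {K : Type*} [Field K] [CharP K 2] {N : ℕ} {G : Type*}
    [AddCommGroup G] (u : G) : IsLieGraded (grading K N u) := by
  intro a b x hx y hy
  rw [mem_grading] at *
  refine ⟨by simp, fun h => ?_, fun h => ?_⟩
  · rw [poly_lie] at h
    by_cases h0 : poly x * form y = 0
    · have h1 : poly y * form x ≠ 0 := fun h1 => h (by rw [h0, h1, sub_zero])
      rw [hx.1 (right_ne_zero_of_mul h1), hy.2.1 (left_ne_zero_of_mul h1), zero_add]
    · rw [hy.1 (right_ne_zero_of_mul h0), hx.2.1 (left_ne_zero_of_mul h0), add_zero]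
  · rw [scalar_lie] at h
    have h0 : poly x * poly y ≠ 0 := fun h0 => h (by rw [h0, coeff_zero])
    rw [hx.2.1 (left_ne_zero_of_mul h0), hy.2.1 (right_ne_zero_of_mul h0)]

/-! ### `PolyLie K N` satisfies the graded identities of `UT3 K` -/

section

variable (K : Type*) [Field K]

/-- The span of the polynomials `f(s) g(t) - g(s) f(t)` in two sets of variables. -/
noncomputable def altSubmodule : Submodule K (MvPolynomial ℕ (MvPolynomial ℕ K)) :=
  Submodule.span K {H | ∃ f g : MvPolynomial ℕ K, H = C f * map C g - C g * map C f}

variable {K}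

/-- The sum of the coefficients of the squarefree monomials `m(s) m'(t)` such that
`m * m' = X 0 * ⋯ * X N` and `X 0` divides `m`. -/
noncomputable def halfCoeff (N : ℕ) : MvPolynomial ℕ (MvPolynomial ℕ K) →ₗ[K] K :=
  ∑ p ∈ Finset.HasAntidiagonal.antidiagonal (sqfreeExp N) with p.1 0 = 1,
    lcoeff K p.1 ∘ₗ (lcoeff (MvPolynomial ℕ K) p.2).restrictScalars K

theorem halfCoeff_mul (N : ℕ) (f g : MvPolynomial ℕ K) :
    halfCoeff N (C f * map C g) =
      ∑ p ∈ Finset.HasAntidiagonal.antidiagonal (sqfreeExp N) with p.1 0 = 1,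
        coeff p.1 f * coeff p.2 g := by
  simp [halfCoeff, coeff_map, mul_comm _ (C _), coeff_C_mul, mul_comm (coeff _ g)]

/-- Swapping the two factors exchanges the splittings with X 0 on the left and those with X 0 on the
right. As signs disappear in characteristic 2, the two halves add up to the full coefficient of the
product. -/
theorem halfCoeff_alt [CharP K 2] (N : ℕ) (f g : MvPolynomial ℕ K) :
    halfCoeff N (C f * map C g - C g * map C f) = coeff (sqfreeExp N) (f * g) := by
  rw [map_sub, CharTwo.sub_eq_add, halfCoeff_mul, halfCoeff_mul, coeff_mul,
    ← Finset.sum_filter_add_sum_filter_not (Finset.HasAntidiagonal.antidiagonal (sqfreeExp N))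
      fun p => p.1 0 = 1]
  congr 1
  have h0 : ∀ p ∈ Finset.HasAntidiagonal.antidiagonal (sqfreeExp N), p.1 0 + p.2 0 = 1 := by
    intro p hp
    have := DFunLike.congr_fun (Finset.HasAntidiagonal.mem_antidiagonal.1 hp) 0
    rwa [Finsupp.add_apply, sqfreeExp_apply, if_pos (by omega)] at this
  refine Finset.sum_nbij' Prod.swap Prod.swap ?_ ?_ (by simp) (by simp) ?_
  · intro p hp
    rw [Finset.mem_filter] at hp ⊢
    have := h0 p hp.1
    refine ⟨Finset.HasAntidiagonal.swap_mem_antidiagonal.2 hp.1, ?_⟩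
    rw [Prod.fst_swap]
    omega
  · intro p hp
    rw [Finset.mem_filter] at hp ⊢
    have := h0 p hp.1
    refine ⟨Finset.HasAntidiagonal.swap_mem_antidiagonal.2 hp.1, ?_⟩
    rw [Prod.fst_swap]
    omega
  · intro p _
    rw [Prod.fst_swap, Prod.snd_swap, mul_comm]

/-- Multiplication by y(s) + y(t) acts on alternating expressions by a Leibniz rule. -/
theorem alt_mul_mem (y : MvPolynomial ℕ K) {H : MvPolynomial ℕ (MvPolynomial ℕ K)}
    (hH : H ∈ altSubmodule K) : H * (C y + map C y) ∈ altSubmodule K := by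
  induction hH using Submodule.span_induction with
  | zero => rw [zero_mul]; exact zero_mem _
  | add a b _ _ ha hb => rw [add_mul]; exact add_mem ha hb
  | smul c a _ ha => rw [smul_mul_assoc]; exact Submodule.smul_mem _ _ ha
  | mem a ha =>
    obtain ⟨f, g, rfl⟩ := ha
    have : (C f * map C g - C g * map C f) * (C y + map C y) =
        (C (f * y) * map C g - C g * map C (f * y)) +
          (C f * map C (g * y) - C (g * y) * map C f) := by
      simp only [map_mul]
      ring
    rw [this]
    exact add_mem (Submodule.subset_span ⟨_, _, rfl⟩) (Submodule.subset_span ⟨_, _, rfl⟩)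

/-- By the Leibniz rule the value is the coefficient of X 0 ⋯ X N in f y g, counted twice. This
matches the centrality of scalars in `PolyLie K N`, although e₁₃ is not central in UT₃. -/
theorem halfCoeff_alt_mul [CharP K 2] (N : ℕ) (y : MvPolynomial ℕ K)
    {H : MvPolynomial ℕ (MvPolynomial ℕ K)} (hH : H ∈ altSubmodule K) :
    halfCoeff N (H * (C y + map C y)) = 0 := by
  induction hH using Submodule.span_induction with
  | zero => rw [zero_mul, map_zero]
  | add a b _ _ ha hb => rw [add_mul, map_add, ha, hb, add_zero]
  | smul c a _ ha => rw [smul_mul_assoc, map_smul, ha, smul_zero]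
  | mem a ha =>
    obtain ⟨f, g, rfl⟩ := ha
    have : (C f * map C g - C g * map C f) * (C y + map C y) =
        (C (f * y) * map C g - C g * map C (f * y)) +
          (C f * map C (g * y) - C (g * y) * map C f) := by
      simp only [map_mul]
      ring
    rw [this, map_add, halfCoeff_alt, halfCoeff_alt, mul_assoc, mul_comm y g,
      CharTwo.add_self_eq_zero]

/-- Evaluation of a polynomial in two sets of variables. -/
noncomputable def eval₂Points (s t : ℕ → K) : MvPolynomial ℕ (MvPolynomial ℕ K) →+* K :=
  (eval s).comp (eval fun i => C (t i))

@[simp] theorem eval₂Points_C (s t : ℕ → K) (f : MvPolynomial ℕ K) :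
    eval₂Points s t (C f) = eval s f := by
  simp [eval₂Points]

@[simp] theorem eval₂Points_map (s t : ℕ → K) (f : MvPolynomial ℕ K) :
    eval₂Points s t (map C f) = eval t f := by
  induction f using MvPolynomial.induction_on with
  | C a => simp [eval₂Points]
  | add p q hp hq => rw [map_add, map_add, hp, hq, map_add]
  | mul_X p i hp => rw [map_mul, map_mul, hp, map_mul]; simp [eval₂Points]

@[simp] theorem eval₂Points_smul (s t : ℕ → K) (c : K) (H : MvPolynomial ℕ (MvPolynomial ℕ K)) :
    eval₂Points s t (c • H) = c * eval₂Points s t H := by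
  have : c • H = C (C c) * H := by
    rw [← smul_eq_C_mul, ← algebraMap_eq, algebraMap_smul]
  rw [this, map_mul, eval₂Points_C, eval_C]

theorem eq_zero_of_eval₂Points [Infinite K] {H : MvPolynomial ℕ (MvPolynomial ℕ K)}
    (hH : ∀ s t, eval₂Points s t H = 0) : H = 0 := by
  -- The outer variables only need to range over the constants, an infinite subset of the
  -- coefficient domain.
  refine MvPolynomial.funext_set (fun _ => Set.range (C : K → MvPolynomial ℕ K))
    (fun _ => Set.infinite_range_of_injective (C_injective ℕ K)) fun x hx => ?_
  choose t ht using fun i => hx i (Set.mem_univ i)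
  obtain rfl : (fun i => C (t i)) = x := funext ht
  refine MvPolynomial.funext fun s => ?_
  rw [map_zero, map_zero]
  exact hH s t

/-- The value at the points `s`, `t` of the generic upper triangular matrix attached to a linear
form `y`, a polynomial `f` and a polynomial `H` in two sets of variables. -/
noncomputable def pointMatrix (y f : MvPolynomial ℕ K) (H : MvPolynomial ℕ (MvPolynomial ℕ K))
    (s t : ℕ → K) : UT3 K :=
  ⟨!![0, eval s f, eval₂Points s t H; 0, eval s y, eval t f; 0, 0, eval s y + eval t y], by
    intro i j hij
    fin_cases i <;> fin_cases j <;> first | rfl | exact absurd hij (by decide)⟩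

theorem pointMatrix_add (y f y' f' : MvPolynomial ℕ K)
    (H H' : MvPolynomial ℕ (MvPolynomial ℕ K)) (s t : ℕ → K) :
    pointMatrix y f H s t + pointMatrix y' f' H' s t =
      pointMatrix (y + y') (f + f') (H + H') s t := by
  ext i j
  fin_cases i <;> fin_cases j <;> simp [pointMatrix]
  ring

theorem pointMatrix_smul (c : K) (y f : MvPolynomial ℕ K)
    (H : MvPolynomial ℕ (MvPolynomial ℕ K)) (s t : ℕ → K) :
    c • pointMatrix y f H s t = pointMatrix (c • y) (c • f) (c • H) s t := by
  ext i j
  fin_cases i <;> fin_cases j <;> simp [pointMatrix, smul_eval]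
  ring

/-- The diagonal differences are y(s), y(t) and y(s) + y(t), the factors by which the diagonal acts
on e₁₂, e₂₃ and e₁₃. The first two superdiagonal entries thus reproduce the polynomial part of the
bracket in `PolyLie`. -/
theorem pointMatrix_lie (y f y' f' : MvPolynomial ℕ K)
    (H H' : MvPolynomial ℕ (MvPolynomial ℕ K)) (s t : ℕ → K) :
    ⁅pointMatrix y f H s t, pointMatrix y' f' H' s t⁆ =
      pointMatrix 0 (f * y' - f' * y) ((C f * map C f' - C f' * map C f) +
        (H * (C y' + map C y') - H' * (C y + map C y))) s t := by
  apply Subtype.ext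
  rw [LieSubalgebra.coe_bracket, Ring.lie_def]
  ext i j
  fin_cases i <;> fin_cases j <;>
    simp [pointMatrix] <;> ring

theorem pointMatrix_zero (s t : ℕ → K) : pointMatrix 0 0 0 s t = (0 : UT3 K) := by
  ext i j
  fin_cases i <;> fin_cases j <;> simp [pointMatrix]

end

/-- Each graded map ψ into `PolyLie K N` is shadowed by graded maps φ s t into UT₃ whose values,
taken over all s, t, determine ψ. -/
theorem gradedId_le {K : Type*} [Field K] [Infinite K] [CharP K 2] (N : ℕ) {G : Type*}
    [AddCommGroup G] (u : G) :
    gradedId (elementaryGrading K u u) ≤ gradedId (grading K N u) := by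
  intro w hw ψ hψ
  let f₀ : MvPolynomial ℕ K := ∏ i ∈ Finset.range (N + 1), X i
  -- An alternating expression on which `halfCoeff` is 1; its multiples encode the scalar parts of
  -- the images of the variables.
  let H₀ : MvPolynomial ℕ (MvPolynomial ℕ K) := C f₀ * map C 1 - C 1 * map C f₀
  have hH₀ : H₀ ∈ altSubmodule K := Submodule.subset_span ⟨_, _, rfl⟩
  have hH₀' : halfCoeff N H₀ = 1 := by
    rw [halfCoeff_alt, mul_one, coeff_sqfreeExp_prod]
  let φ : (s t : ℕ → K) → FreeGr K G →ₗ⁅K⁆ UT3 K := fun s t => FreeLieAlgebra.lift K fun p =>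
    pointMatrix (form (ψ (var K p.1 p.2))) (poly (ψ (var K p.1 p.2)))
      (scalar (ψ (var K p.1 p.2)) • H₀) s t
  have hφv : ∀ s t i g, φ s t (var K i g) = pointMatrix (form (ψ (var K i g)))
      (poly (ψ (var K i g))) (scalar (ψ (var K i g)) • H₀) s t := by
    intro s t i g
    exact FreeLieAlgebra.lift_of_apply _ _
  have hφ : ∀ s t, IsGradedHom (freeGrading K G) (elementaryGrading K u u) (φ s t) := by
    intro s t
    refine (isLieGraded_elementaryGrading u u).isGradedHom fun i g => ?_
    rw [hφv]
    obtain ⟨h₁, h₂, h₃⟩ := mem_grading.1 (hψ g _ (var_mem_freeGrading i g))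
    generalize ψ (var K i g) = x at *
    have e₁ : ∀ r : ℕ → K, eval r (form x) ≠ 0 → g = 0 := fun r hr =>
      h₁ fun h => hr (by rw [h, map_zero])
    have e₂ : ∀ r : ℕ → K, eval r (poly x) ≠ 0 → g = u := fun r hr =>
      h₂ fun h => hr (by rw [h, map_zero])
    have e₃ : eval₂Points s t (scalar x • H₀) ≠ 0 → g = u + u := fun hr =>
      h₃ fun h => hr (by rw [h, zero_smul, map_zero])
    have e₄ : eval s (form x) + eval t (form x) ≠ 0 → g = 0 := fun hr =>
      h₁ fun h => hr (by rw [h, map_zero, map_zero, add_zero])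
    have a₁ := e₁ s
    have a₂ := e₂ s
    have a₃ := e₂ t
    intro i j hij
    fin_cases i <;> fin_cases j
    · exact absurd rfl hij
    · simpa [unitDegree] using (a₂ hij).symm
    · simpa [unitDegree] using (e₃ hij).symm
    · exact absurd rfl hij
    · simpa [unitDegree] using (a₁ hij).symm
    · simpa [unitDegree] using (a₃ hij).symm
    · exact absurd rfl hij
    · exact absurd rfl hij
    · simpa [unitDegree] using (e₄ hij).symm
  -- The elements whose image under φ has an alternating corner entry from which `halfCoeff`
  -- recovers the scalar part of ψ. One polynomial H has to serve all s and t.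
  let S : LieSubalgebra K (FreeGr K G) :=
    { carrier := {v | ∃ H ∈ altSubmodule K, halfCoeff N H = scalar (ψ v) ∧
        ∀ s t, φ s t v = pointMatrix (form (ψ v)) (poly (ψ v)) H s t}
      zero_mem' := ⟨0, zero_mem _, by simp, fun s t => by simp [pointMatrix_zero]⟩
      add_mem' := by
        rintro v v' ⟨H, hH, h₁, h₂⟩ ⟨H', hH', h₁', h₂'⟩
        refine ⟨H + H', add_mem hH hH', by simp [h₁, h₁'], fun s t => ?_⟩
        rw [map_add, h₂, h₂', pointMatrix_add]
        simp
      smul_mem' := by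
        rintro c v ⟨H, hH, h₁, h₂⟩
        refine ⟨c • H, Submodule.smul_mem _ _ hH, by simp [h₁], fun s t => ?_⟩
        rw [map_smul, h₂, pointMatrix_smul]
        simp
      lie_mem' := by
        rintro v v' ⟨H, hH, h₁, h₂⟩ ⟨H', hH', h₁', h₂'⟩
        refine ⟨_, add_mem (Submodule.subset_span ⟨poly (ψ v), poly (ψ v'), rfl⟩)
          (sub_mem (alt_mul_mem (form (ψ v')) hH) (alt_mul_mem (form (ψ v)) hH')), ?_,
          fun s t => ?_⟩
        · rw [map_add, halfCoeff_alt, map_sub, halfCoeff_alt_mul N _ hH,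
            halfCoeff_alt_mul N _ hH', LieHom.map_lie, scalar_lie, sub_zero, add_zero]
        · rw [LieHom.map_lie, h₂, h₂', pointMatrix_lie, LieHom.map_lie]
          simp }
  obtain ⟨H, -, hH, hφw⟩ := mem_of_var_mem S (fun i g => ⟨scalar (ψ (var K i g)) • H₀,
    Submodule.smul_mem _ _ hH₀, by rw [map_smul, hH₀', smul_eq_mul, mul_one],
    fun s t => hφv s t i g⟩) w
  have h0 : ∀ s t i j, (pointMatrix (form (ψ w)) (poly (ψ w)) H s t :
      Matrix (Fin 3) (Fin 3) K) i j = 0 := by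
    intro s t i j
    rw [← hφw, hw _ (hφ s t)]
    rfl
  ext1
  · refine MvPolynomial.funext fun s => ?_
    rw [map_zero, map_zero]
    -- The second diagonal entry is the linear form at s; the point t plays no role.
    exact h0 s 0 1 1
  · refine MvPolynomial.funext fun s => ?_
    rw [map_zero, map_zero]
    exact h0 s 0 0 1
  · rw [← hH, eq_zero_of_eval₂Points fun s t => h0 s t 0 2, map_zero, map_zero]

end PolyLie

theorem zmod_two_eq_zero_or_one : ∀ h : ZMod 2, h = 0 ∨ h = 1 := by decide

/-! ### T-ideals -/

theorem mem_iSup_of_monotone {K G : Type*} [Field K] {I : ℕ → LieIdeal K (FreeGr K G)} (hI : Monotone I)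
    {f : FreeGr K G} : f ∈ ⨆ n, I n ↔ ∃ n, f ∈ I n := by
  rw [← LieSubmodule.mem_toSubmodule, LieSubmodule.iSup_toSubmodule,
    Submodule.mem_iSup_of_directed _ (Monotone.directed_le fun m n h => hI h)]
  rfl

section

variable {K G M : Type*} [Field K] [AddCommGroup G] [LieRing M] [LieAlgebra K M]

theorem isTIdeal_gradedId (Γ : G → Submodule K M) : IsTIdeal (gradedId Γ) :=
  fun φ hφ _ hf ψ hψ => hf (ψ.comp φ) fun g x hx => hψ g _ (hφ g x hx)

theorem mem_tSpan {S : Set (FreeGr K G)} {f : FreeGr K G} :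
    f ∈ tSpan S ↔ ∀ I : LieIdeal K (FreeGr K G), IsTIdeal I → S ⊆ I → f ∈ I := by
  rw [tSpan, ← LieSubmodule.mem_toSubmodule, LieSubmodule.sInf_toSubmodule, Submodule.mem_sInf]
  simp only [Set.mem_ofPred_eq, forall_exists_index, and_imp]
  exact ⟨fun h I h₁ h₂ => h _ I h₁ h₂ rfl, fun h _ I h₁ h₂ e => e ▸ h I h₁ h₂⟩

theorem subset_tSpan (S : Set (FreeGr K G)) : S ⊆ tSpan S :=
  fun _ hf => mem_tSpan.2 fun _ _ h => h hf

theorem tSpan_le {S : Set (FreeGr K G)} {I : LieIdeal K (FreeGr K G)} (hI : IsTIdeal I)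
    (hS : S ⊆ I) : tSpan S ≤ I :=
  fun _ hf => mem_tSpan.1 hf I hI hS

theorem isTIdeal_tSpan (S : Set (FreeGr K G)) : IsTIdeal (tSpan S) :=
  fun φ hφ f hf => mem_tSpan.2 fun _ hI hS => hI φ hφ f (tSpan_le hI hS hf)

theorem tSpan_mono {S T : Set (FreeGr K G)} (h : S ⊆ T) : tSpan S ≤ tSpan T :=
  tSpan_le (isTIdeal_tSpan T) (h.trans (subset_tSpan T))

theorem IsTIdeal.sup {I J : LieIdeal K (FreeGr K G)} (hI : IsTIdeal I) (hJ : IsTIdeal J) :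
    IsTIdeal (I ⊔ J) := by
  intro φ hφ f hf
  obtain ⟨a, ha, b, hb, rfl⟩ := (LieSubmodule.mem_sup _ _ _).1 hf
  rw [map_add]
  exact add_mem (LieSubmodule.mem_sup_left (hI φ hφ a ha))
    (LieSubmodule.mem_sup_right (hJ φ hφ b hb))

/-- A strictly ascending chain of T-ideals above `I` shows that `I` is not Specht. -/
theorem not_hasSpechtProperty_of_strictMono {I : LieIdeal K (FreeGr K G)}
    {J : ℕ → LieIdeal K (FreeGr K G)} (hJ : StrictMono J) (hT : ∀ n, IsTIdeal (J n))
    (hIJ : I ≤ J 0) : ¬ HasSpechtProperty I := by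
  intro h
  have hTs : IsTIdeal (⨆ n, J n) := by
    intro φ hφ f hf
    obtain ⟨n, hn⟩ := (mem_iSup_of_monotone hJ.monotone).1 hf
    exact (mem_iSup_of_monotone hJ.monotone).2 ⟨n, hT n φ hφ f hn⟩
  obtain ⟨S, hS, hSJ⟩ := h _ hTs (hIJ.trans (le_iSup J 0))
  have hmem : ∀ f ∈ S, ∃ n, f ∈ J n := by
    intro f hf
    rw [← mem_iSup_of_monotone hJ.monotone, hSJ]
    exact subset_tSpan S hf
  choose! m hm using hmem
  obtain ⟨n, hn⟩ := (hS.image m).bddAbove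
  -- Finitely many generators all lie in one stage, so the chain would stop there.
  have hle : J (n + 1) ≤ J n := by
    refine (le_iSup J (n + 1)).trans ?_
    rw [hSJ]
    exact tSpan_le (hT n) fun f hf => hJ.monotone (hn ⟨f, hf, rfl⟩) (hm f hf)
  exact absurd hle (hJ (Nat.lt_succ_self n)).not_ge

end

theorem map_lie_foldl_lie {K L M : Type*} [Field K] [LieRing L] [LieAlgebra K L] [LieRing M]
    [LieAlgebra K M] (φ : L →ₗ⁅K⁆ M) (y : ℕ → L) (l : List ℕ) (z : L) :
    φ ⁅l.foldl (fun w i => ⁅w, y i⁆) z, z⁆ =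
      ⁅l.foldl (fun w i => ⁅w, φ (y i)⁆) (φ z), φ z⁆ := by
  rw [LieHom.map_lie]
  congr 1
  generalize z = v
  induction l generalizing v with
  | nil => rfl
  | cons i l ih => rw [List.foldl_cons, List.foldl_cons, ih, LieHom.map_lie]

/-! ### The commutators c_k in the test algebra -/

namespace PolyLie

section

variable {K : Type*} [Field K] {N : ℕ}

theorem lie_foldl_lie_eq_zero [CharP K 2] {k : ℕ} (hk : k < N + 1) {m : ℕ → PolyLie K N}
    (hm : ∀ i, poly (m i) = 0) {x : PolyLie K N} (hx : form x = 0) (hx' : scalar x = 0) :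
    ⁅(List.range k).foldl (fun w i => ⁅w, m i⁆) x, x⁆ = 0 := by
  rw [lie_foldl_lie m _ (fun i _ => hm i) x hx hx',
    coeff_sqfreeExp_sq_mul (k := k) hk (by simpa using isHomogeneous_prod_form m (List.range k))]
  rfl

theorem lie_foldl_lie_ne_zero {m : ℕ → PolyLie K N} (hm : ∀ i, poly (m i) = 0)
    (hm' : ∀ i, form (m i) = X i) {x : PolyLie K N} (hx : form x = 0) (hx' : scalar x = 0)
    (hx'' : poly x = 1) :
    ⁅(List.range (N + 1)).foldl (fun w i => ⁅w, m i⁆) x, x⁆ ≠ 0 := by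
  rw [lie_foldl_lie m _ (fun i _ => hm i) x hx hx', hx'', mul_one, one_mul]
  intro h
  have h' := congrArg scalar h
  simp only [hm'] at h'
  rw [scalar_mk, map_zero] at h'
  exact one_ne_zero ((coeff_sqfreeExp_prod K N).symm.trans h')

/-- The graded homomorphism that sends `x_{i+1,0}` to the linear form `X i`, the variables of
degree `u` to the polynomial `1`, and the other variables to `0`. -/
theorem exists_gradedHom {G : Type*} [AddCommGroup G] (K : Type*) [Field K] [CharP K 2] (N : ℕ)
    {u : G} (hu : u ≠ 0) : ∃ ψ : FreeGr K G →ₗ⁅K⁆ PolyLie K N,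
      IsGradedHom (freeGrading K G) (grading K N u) ψ ∧
      (∀ i, ψ (var K (i + 1) 0) = mk ⟨X i, isHomogeneous_X K i⟩ 0 0) ∧
      (∀ i, ψ (var K i u) = mk 0 1 0) ∧ ∀ i g, g ≠ 0 → g ≠ u → ψ (var K i g) = 0 := by
  classical
  -- The shift by one is needed because the commutators start with y_1 and the squarefree monomial
  -- with X 0. The value at index 0 is immaterial.
  let ψ : FreeGr K G →ₗ⁅K⁆ PolyLie K N := FreeLieAlgebra.lift K fun p =>
    if p.2 = 0 then mk ⟨X (p.1 - 1), isHomogeneous_X K _⟩ 0 0 else if p.2 = u then mk 0 1 0 else 0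
  have hψ : ∀ i g, ψ (var K i g) = if g = 0 then mk ⟨X (i - 1), isHomogeneous_X K _⟩ 0 0
      else if g = u then mk 0 1 0 else 0 := fun i g => FreeLieAlgebra.lift_of_apply _ _
  refine ⟨ψ, (isLieGraded_grading u).isGradedHom fun i g => ?_, fun i => ?_, fun i => ?_,
    fun i g h₀ h₁ => ?_⟩
  · rw [hψ]
    split_ifs with h₀ h₁
    · exact mem_grading.2 ⟨fun _ => h₀, fun h => absurd rfl h, fun h => absurd rfl h⟩
    · exact mem_grading.2 ⟨fun h => absurd rfl h, fun _ => h₁, fun h => absurd rfl h⟩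
    · exact zero_mem _
  · rw [hψ, if_pos rfl]
    rfl
  · rw [hψ, if_neg hu, if_pos rfl]
  · rw [hψ, if_neg h₀, if_neg h₁]

end

end PolyLie

/-! ### The elementary gradings and their coarsenings -/

section

variable {K : Type*} [Field K]

/-- The part of an upper triangular matrix at position `(i, j)`. -/
def UT3.entryPart (A : UT3 K) (i j : Fin 3) : UT3 K :=
  ⟨Matrix.single i j ((A : Matrix (Fin 3) (Fin 3) K) i j), by
    intro k l hlk
    by_cases h : i = k ∧ j = l
    · obtain ⟨rfl, rfl⟩ := h
      rw [Matrix.single_apply_same]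
      exact A.2 _ _ hlk
    · exact Matrix.single_apply_of_ne _ _ _ _ _ h⟩

theorem UT3.sum_entryPart (A : UT3 K) : ∑ i, ∑ j, UT3.entryPart A i j = A := by
  apply Subtype.ext
  conv_rhs => rw [Matrix.matrix_eq_sum_single (A : Matrix (Fin 3) (Fin 3) K)]
  simp [UT3.entryPart]

theorem UT3.entryPart_mem {G : Type*} [AddCommGroup G] (g h : G) (A : UT3 K) (i j : Fin 3) :
    UT3.entryPart A i j ∈ elementaryGrading K g h (unitDegree g h i j) := by
  intro k l hkl
  by_cases e : i = k ∧ j = l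
  · rw [e.1, e.2]
  · exact absurd (Matrix.single_apply_of_ne _ _ _ _ _ e) hkl

theorem map_unitDegree {G H : Type*} [AddCommGroup G] [AddCommGroup H] (α : G →+ H) (g h : G)
    (i j : Fin 3) : α (unitDegree g h i j) = unitDegree (α g) (α h) i j := by
  have : ∀ i, α (![0, g, g + h] i) = ![0, α g, α g + α h] i := by
    intro i
    fin_cases i <;> simp
  rw [unitDegree, map_sub, this, this, unitDegree]

/-- Cutting a matrix into its single entries splits a coarse component into fine homogeneous parts.
-/
theorem coarsening_elementaryGrading {G H : Type*} [AddCommGroup G] [AddCommGroup H] (α : G →+ H)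
    (g h : G) : coarsening α (elementaryGrading K g h) = elementaryGrading K (α g) (α h) := by
  funext a
  refine le_antisymm (iSup_le ?_) fun A hA => ?_
  · rintro ⟨b, rfl⟩ A hA i j hij
    rw [← map_unitDegree, hA i j hij]
  · rw [← UT3.sum_entryPart A]
    refine sum_mem fun i _ => sum_mem fun j _ => ?_
    by_cases h0 : (A : Matrix (Fin 3) (Fin 3) K) i j = 0
    · have : UT3.entryPart A i j = 0 := by
        apply Subtype.ext
        simp [UT3.entryPart, h0]
      rw [this]
      exact zero_mem _
    · exact Submodule.mem_iSup_of_mem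
        (⟨unitDegree g h i j, by rw [map_unitDegree, hA i j h0]⟩ : {g : G // α g = a})
        (UT3.entryPart_mem g h A i j)

variable (K)

theorem canonicalGrading_ne_bot_iff (g : ℤ) :
    canonicalGrading K g ≠ ⊥ ↔ g = 0 ∨ g = 1 ∨ g = 2 := by
  rw [Submodule.ne_bot_iff]
  constructor
  · rintro ⟨A, hA, hA0⟩
    have : ∃ i j, (A : Matrix (Fin 3) (Fin 3) K) i j ≠ 0 := by
      by_contra! h
      exact hA0 (Subtype.ext (Matrix.ext h))
    obtain ⟨i, j, hij⟩ := this
    have hle : i ≤ j := not_lt.1 fun h => hij (A.2 i j h)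
    rw [← hA i j hij]
    revert hle
    clear hij
    revert i j
    decide
  · intro hg
    have : ∃ i j : Fin 3, i ≤ j ∧ unitDegree (1 : ℤ) 1 i j = g := by
      rcases hg with rfl | rfl | rfl
      · exact ⟨0, 0, by decide⟩
      · exact ⟨0, 1, by decide⟩
      · exact ⟨0, 2, by decide⟩
    obtain ⟨i, j, hle, rfl⟩ := this
    let A : UT3 K := ⟨Matrix.of fun i j => if j < i then 0 else 1, fun i j h => if_pos h⟩
    refine ⟨UT3.entryPart A i j, UT3.entryPart_mem 1 1 A i j, fun h => ?_⟩
    have h' := congrArg (fun B : UT3 K => (B : Matrix (Fin 3) (Fin 3) K) i j) h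
    simp [UT3.entryPart, A, hle.not_gt] at h'

theorem transfer_var_zero (i : ℕ) :
    transfer proj (canonicalGrading K) (var K i 0) = var K i 0 + var K i 2 := by
  have hs : {g : ℤ | proj g = 0 ∧ canonicalGrading K g ≠ ⊥} = {0, 2} := by
    ext g
    rw [Set.mem_ofPred_eq, canonicalGrading_ne_bot_iff]
    constructor
    · rintro ⟨h, rfl | rfl | rfl⟩
      · simp
      · exact absurd h (by decide)
      · simp
    · rintro (rfl | rfl)
      · exact ⟨by decide, by simp⟩
      · exact ⟨by decide, by simp⟩
  refine (FreeLieAlgebra.lift_of_apply _ _).trans ?_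
  rw [hs, finsum_mem_pair (by decide)]

theorem transfer_var_one (i : ℕ) :
    transfer proj (canonicalGrading K) (var K i 1) = var K i 1 := by
  have hs : {g : ℤ | proj g = 1 ∧ canonicalGrading K g ≠ ⊥} = {1} := by
    ext g
    rw [Set.mem_ofPred_eq, canonicalGrading_ne_bot_iff]
    constructor
    · rintro ⟨h, rfl | rfl | rfl⟩
      · exact absurd h (by decide)
      · simp
      · exact absurd h (by decide)
    · rintro rfl
      exact ⟨by decide, by simp⟩
  refine (FreeLieAlgebra.lift_of_apply _ _).trans ?_
  rw [hs, finsum_mem_singleton]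

theorem transfer_c (k : ℕ) :
    transfer proj (canonicalGrading K) (c K k) =
      ⁅(List.range k).foldl (fun w i => ⁅w, var K (i + 1) (0 : ℤ) + var K (i + 1) 2⁆)
        (var K 1 1), var K 1 1⁆ := by
  rw [c, map_lie_foldl_lie (transfer proj (canonicalGrading K)) fun i => var K (i + 1) 0]
  simp only [transfer_var_zero, transfer_var_one]

end

/-! ### The two chains -/

section

variable (K : Type*) [Field K]

theorem isTIdeal_canonicalChain (n : ℕ) : IsTIdeal (canonicalChain K n) :=
  (isTIdeal_tSpan _).sup (isTIdeal_gradedId _)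

theorem isTIdeal_almostCanonicalChain (n : ℕ) : IsTIdeal (almostCanonicalChain K n) :=
  (isTIdeal_tSpan _).sup (isTIdeal_gradedId _)

theorem strictMono_almostCanonicalChain [Infinite K] [CharP K 2] :
    StrictMono (almostCanonicalChain K) := by
  refine strictMono_nat_of_lt_succ fun n => lt_of_le_not_ge ?_ fun hle => ?_
  · exact sup_le_sup_right
      (tSpan_mono (Set.image_mono (Set.Icc_subset_Icc_right (by omega)))) _
  -- With N = n + 2 the test algebra satisfies every generator of this stage, and c_{n+3} = c_{N+1}
  -- is the first commutator to survive.
  have h₁ : almostCanonicalChain K n ≤ gradedId (PolyLie.grading K (n + 2) (1 : ZMod 2)) := by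
    refine sup_le (tSpan_le (isTIdeal_gradedId _) ?_) (PolyLie.gradedId_le (n + 2) 1)
    rintro _ ⟨k, hk, rfl⟩ ψ hψ
    rw [c, map_lie_foldl_lie ψ fun i => var K (i + 1) 0]
    -- As 1 differs from 0 and from 1 + 1, an element of degree 1 has only a polynomial part.
    have hz := PolyLie.mem_grading.1 (hψ 1 _ (var_mem_freeGrading 1 1))
    refine PolyLie.lie_foldl_lie_eq_zero (Nat.lt_succ_of_le hk.2) (fun i => ?_)
      (not_not.1 (mt hz.1 (by decide))) (not_not.1 (mt hz.2.2 (by decide)))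
    exact not_not.1 (mt (PolyLie.mem_grading.1 (hψ 0 _ (var_mem_freeGrading (i + 1) 0))).2.1
      (by decide))
  obtain ⟨ψ, hψ, hy, hz, -⟩ := PolyLie.exists_gradedHom K (n + 2) (one_ne_zero (α := ZMod 2))
  have h₂ : ψ (c K (n + 3)) = 0 :=
    h₁ (hle (LieSubmodule.mem_sup_left (subset_tSpan _ ⟨n + 3, ⟨by omega, by omega⟩, rfl⟩))) ψ hψ
  rw [c, map_lie_foldl_lie ψ fun i => var K (i + 1) 0] at h₂
  refine PolyLie.lie_foldl_lie_ne_zero (fun i => ?_) (fun i => ?_) ?_ ?_ ?_ h₂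
  · rw [hy, PolyLie.poly_mk]
  · rw [hy, PolyLie.form_mk]
  · rw [hz, PolyLie.form_mk]
    rfl
  · rw [hz, PolyLie.scalar_mk]
  · rw [hz, PolyLie.poly_mk]

theorem strictMono_canonicalChain [Infinite K] [CharP K 2] : StrictMono (canonicalChain K) := by
  refine strictMono_nat_of_lt_succ fun n => lt_of_le_not_ge ?_ fun hle => ?_
  · exact sup_le_sup_right
      (tSpan_mono (Set.image_mono (Set.Icc_subset_Icc_right (by omega)))) _
  have h₁ : canonicalChain K n ≤ gradedId (PolyLie.grading K (n + 2) (1 : ℤ)) := by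
    refine sup_le (tSpan_le (isTIdeal_gradedId _) ?_) (PolyLie.gradedId_le (n + 2) 1)
    rintro _ ⟨k, hk, rfl⟩ ψ hψ
    beta_reduce
    rw [transfer_c, map_lie_foldl_lie ψ fun i => var K (i + 1) (0 : ℤ) + var K (i + 1) 2]
    have hz := PolyLie.mem_grading.1 (hψ 1 _ (var_mem_freeGrading 1 1))
    refine PolyLie.lie_foldl_lie_eq_zero (Nat.lt_succ_of_le hk.2) (fun i => ?_)
      (not_not.1 (mt hz.1 (by decide))) (not_not.1 (mt hz.2.2 (by decide)))
    -- Neither degree 0 nor degree 2 admits a polynomial part, so the extra summand of π(y_i) does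
    -- no harm.
    rw [map_add, map_add,
      not_not.1 (mt (PolyLie.mem_grading.1 (hψ 0 _ (var_mem_freeGrading (i + 1) 0))).2.1
        (by decide)),
      not_not.1 (mt (PolyLie.mem_grading.1 (hψ 2 _ (var_mem_freeGrading (i + 1) 2))).2.1
        (by decide)), add_zero]
  obtain ⟨ψ, hψ, hy, hz, ho⟩ := PolyLie.exists_gradedHom K (n + 2) (one_ne_zero (α := ℤ))
  have h₂ : ψ (transfer proj (canonicalGrading K) (c K (n + 3))) = 0 :=
    h₁ (hle (LieSubmodule.mem_sup_left (subset_tSpan _ ⟨n + 3, ⟨by omega, by omega⟩, rfl⟩))) ψ hψ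
  rw [transfer_c, map_lie_foldl_lie ψ fun i => var K (i + 1) (0 : ℤ) + var K (i + 1) 2] at h₂
  have hy' : ∀ i, ψ (var K (i + 1) (0 : ℤ) + var K (i + 1) 2) =
      PolyLie.mk ⟨X i, isHomogeneous_X K i⟩ 0 0 := by
    intro i
    rw [map_add, hy, ho _ 2 (by decide) (by decide), add_zero]
  refine PolyLie.lie_foldl_lie_ne_zero (fun i => ?_) (fun i => ?_) ?_ ?_ ?_ h₂
  · rw [hy', PolyLie.poly_mk]
  · rw [hy', PolyLie.form_mk]
  · rw [hz, PolyLie.form_mk]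
    rfl
  · rw [hz, PolyLie.scalar_mk]
  · rw [hz, PolyLie.poly_mk]

theorem coarsening_canonicalGrading :
    coarsening proj (canonicalGrading K) = almostCanonicalGrading K := by
  rw [canonicalGrading, coarsening_elementaryGrading, almostCanonicalGrading]
  simp [proj]

/-! ### The transfer homomorphism -/

/-- Composing a ℤ-graded evaluation with π gives a ℤ/2-graded evaluation, since UT₃ carries the
coarsened grading. -/
theorem transfer_mem_gradedId {f : FreeGr K (ZMod 2)}
    (hf : f ∈ gradedId (almostCanonicalGrading K)) :
    transfer proj (canonicalGrading K) f ∈ gradedId (canonicalGrading K) := by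
  intro ψ hψ
  refine hf (ψ.comp (transfer proj (canonicalGrading K)))
    ((isLieGraded_elementaryGrading 1 1).isGradedHom fun i h => ?_)
  have key : ∀ g : ℤ, ψ (var K i g) ∈ almostCanonicalGrading K (proj g) := by
    intro g
    rw [← coarsening_canonicalGrading]
    exact Submodule.mem_iSup_of_mem (⟨g, rfl⟩ : {g' : ℤ // proj g' = proj g})
      (hψ g _ (var_mem_freeGrading i g))
  rw [LieHom.comp_apply]
  have hh := zmod_two_eq_zero_or_one h
  rcases hh with rfl | rfl
  · rw [transfer_var_zero, map_add]
    exact add_mem (key 0) (key 2)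
  · rw [transfer_var_one]
    exact key 1

/-- Modulo identities, an element of the coarsened free algebra is a sum of elements of degrees in
the support of the canonical grading. -/
theorem exists_sub_mem_gradedId (h : ZMod 2) {w : FreeGr K ℤ}
    (hw : w ∈ coarsening proj (freeGrading K ℤ) h) :
    ∃ u : ℤ → FreeGr K ℤ, (∀ g, u g ∈ freeGrading K ℤ g) ∧
      w - (if h = 0 then u 0 + u 2 else u 1) ∈ gradedId (canonicalGrading K) := by
  induction hw using Submodule.iSup_induction' with
  | zero => exact ⟨0, fun g => zero_mem _, by simp⟩
  | add x y _ _ hx hy =>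
    obtain ⟨u, hu, hxu⟩ := hx
    obtain ⟨v, hv, hyv⟩ := hy
    refine ⟨u + v, fun g => add_mem (hu g) (hv g), ?_⟩
    have := add_mem hxu hyv
    split_ifs at this ⊢
    · convert this using 1
      simp only [Pi.add_apply]
      abel
    · convert this using 1
      simp only [Pi.add_apply]
      abel
  | mem g x hx =>
    obtain ⟨g, rfl⟩ := g
    refine ⟨Pi.single g x, fun g' => ?_, ?_⟩
    · by_cases e : g' = g
      · subst e
        rwa [Pi.single_eq_same]
      · rw [Pi.single_eq_of_ne e]
        exact zero_mem _
    -- A homogeneous element of degree outside the support is itself an identity and may be dropped.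
    · by_cases hg : canonicalGrading K g = ⊥
      · have hne := mt (canonicalGrading_ne_bot_iff K g).2 (not_not.2 hg)
        push Not at hne
        have hx0 : x ∈ gradedId (canonicalGrading K) := by
          intro φ hφ
          have := hφ g x hx
          rwa [hg, Submodule.mem_bot] at this
        rw [Pi.single_eq_of_ne hne.1.symm, Pi.single_eq_of_ne hne.2.1.symm,
          Pi.single_eq_of_ne hne.2.2.symm]
        simpa using hx0
      · rcases (canonicalGrading_ne_bot_iff K g).1 hg with rfl | rfl | rfl
        · simp
        · rw [if_neg (by decide)]
          simp
        · rw [if_pos (by decide)]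
          simp

/-- Graded endomorphisms lift along the transfer homomorphism, modulo identities. -/
theorem exists_lift_transfer {φ : FreeGr K (ZMod 2) →ₗ⁅K⁆ FreeGr K (ZMod 2)}
    (hφ : IsGradedHom (freeGrading K (ZMod 2)) (freeGrading K (ZMod 2)) φ) :
    ∃ φ' : FreeGr K ℤ →ₗ⁅K⁆ FreeGr K ℤ, IsGradedHom (freeGrading K ℤ) (freeGrading K ℤ) φ' ∧
      ∀ f, transfer proj (canonicalGrading K) (φ f) -
        φ' (transfer proj (canonicalGrading K) f) ∈ gradedId (canonicalGrading K) := by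
  have hπ : IsGradedHom (freeGrading K (ZMod 2)) (coarsening proj (freeGrading K ℤ))
      (transfer proj (canonicalGrading K)) := by
    refine (isLieGraded_freeGrading.coarsening proj).isGradedHom fun i h => ?_
    have key : ∀ g : ℤ, var K i g ∈ coarsening proj (freeGrading K ℤ) (proj g) := fun g =>
      Submodule.mem_iSup_of_mem (⟨g, rfl⟩ : {g' : ℤ // proj g' = proj g}) (var_mem_freeGrading i g)
    have hh := zmod_two_eq_zero_or_one h
    rcases hh with rfl | rfl
    · rw [transfer_var_zero]
      exact add_mem (key 0) (key 2)
    · rw [transfer_var_one]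
      exact key 1
  choose u hu hsub using fun (i : ℕ) (h : ZMod 2) =>
    exists_sub_mem_gradedId K h (hπ h _ (hφ h _ (var_mem_freeGrading i h)))
  -- The variable of degree g goes to the degree g component of π(φ(x_i)), with x_i of degree g mod
  -- 2. Summing over the support then recovers π(φ(x_i)) modulo identities.
  let φ' : FreeGr K ℤ →ₗ⁅K⁆ FreeGr K ℤ := FreeLieAlgebra.lift K fun p => u p.1 (proj p.2) p.2
  have hφ' : ∀ i g, φ' (var K i g) = u i (proj g) g := fun i g =>
    FreeLieAlgebra.lift_of_apply _ _
  refine ⟨φ', isLieGraded_freeGrading.isGradedHom fun i g => ?_, fun f ψ hψ => ?_⟩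
  · rw [hφ']
    exact hu i _ g
  have heq : ψ.comp ((transfer proj (canonicalGrading K)).comp φ) =
      ψ.comp (φ'.comp (transfer proj (canonicalGrading K))) := by
    refine FreeLieAlgebra.hom_ext fun ⟨i, h⟩ => ?_
    have hs := hsub i h ψ hψ
    rw [map_sub, sub_eq_zero] at hs
    refine hs.trans (congrArg ψ ?_)
    change _ = φ' (transfer proj (canonicalGrading K) (var K i h))
    have hh := zmod_two_eq_zero_or_one h
    rcases hh with rfl | rfl
    · rw [transfer_var_zero, map_add, hφ', hφ', if_pos rfl]
      rfl
    · rw [transfer_var_one, hφ', if_neg (by decide)]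
      rfl
  rw [map_sub, sub_eq_zero]
  exact congrArg (fun F : FreeGr K (ZMod 2) →ₗ⁅K⁆ UT3 K => F f) heq

theorem transfer_mem_canonicalChain (n : ℕ) {f : FreeGr K (ZMod 2)}
    (hf : f ∈ almostCanonicalChain K n) :
    transfer proj (canonicalGrading K) f ∈ canonicalChain K n := by
  have hle : almostCanonicalChain K n ≤
      (canonicalChain K n).comap (transfer proj (canonicalGrading K)) := by
    -- The preimage of a stage under π is a T-ideal: φ is replaced by its lift, and the error is an
    -- identity, which the stage contains.
    refine sup_le (tSpan_le (fun φ hφ f hf => ?_) ?_) fun f hf => ?_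
    · rw [LieIdeal.mem_comap] at hf ⊢
      obtain ⟨φ', hφ', hsub⟩ := exists_lift_transfer K hφ
      rw [← sub_add_cancel (transfer proj (canonicalGrading K) (φ f))
        (φ' (transfer proj (canonicalGrading K) f))]
      exact add_mem (LieSubmodule.mem_sup_right (hsub f))
        (isTIdeal_canonicalChain K n φ' hφ' _ hf)
    · rintro _ ⟨k, hk, rfl⟩
      exact LieIdeal.mem_comap.2 (LieSubmodule.mem_sup_left (subset_tSpan _ ⟨k, hk, rfl⟩))
    · exact LieIdeal.mem_comap.2 (LieSubmodule.mem_sup_right (transfer_mem_gradedId K hf))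
  exact LieIdeal.mem_comap.1 (hle hf)

end

end GradedIdentities

theorem mainTheorem9 (K : Type*) [Field K] [Infinite K] [CharP K 2] :
    ¬ GradedIdentities.HasSpechtProperty
        (GradedIdentities.gradedId (GradedIdentities.almostCanonicalGrading K)) ∧
    GradedIdentities.coarsening GradedIdentities.proj (GradedIdentities.canonicalGrading K) =
      GradedIdentities.almostCanonicalGrading K ∧
    StrictMono (GradedIdentities.canonicalChain K) ∧
    StrictMono (GradedIdentities.almostCanonicalChain K) ∧
    ∀ n, ∀ f ∈ GradedIdentities.almostCanonicalChain K n,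
      GradedIdentities.transfer GradedIdentities.proj (GradedIdentities.canonicalGrading K) f ∈
        GradedIdentities.canonicalChain K n :=
  ⟨GradedIdentities.not_hasSpechtProperty_of_strictMono
      (GradedIdentities.strictMono_almostCanonicalChain K)
      (GradedIdentities.isTIdeal_almostCanonicalChain K) le_sup_right,
    GradedIdentities.coarsening_canonicalGrading K,
    GradedIdentities.strictMono_canonicalChain K,
    GradedIdentities.strictMono_almostCanonicalChain K,
    fun n _ hf => GradedIdentities.transfer_mem_canonicalChain K n hf⟩
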